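/- All cellular automata (CA) below are one-dimensional. A stochastic CA is a tuple $\mathcal A=(Q,R,V,V',f)$ with $Q$ (states) and $R$ (random symbols) non-empty finite sets, $V=\{v_1,\dots,v_\rho\}$ and $V'=\{v'_1,\dots,v'_{\rho'}\}$ finite subsets of $\mathbb Z$, and $f:Q^{\rho}\times R^{\rho'}\to Q$. Its explicit global function $F:Q^{\mathbb Z}\times R^{\mathbb Z}\to Q^{\mathbb Z}$ is $$F(c,s)_z=f\bigl((c_{z+v_1},\dots,c_{z+v_\rho}),(s_{z+v'_1},\dots,s_{z+v'_{\rho'}})\bigr),$$ its iterates are $F^0(c)=c$, $F^{t+1}(c,s^1,\dots,s^{t+1})=F(F^t(c,s^1,\dots,s^t),s^{t+1})$, and its non-deterministic global function is $N_F(c)=\{F(c,s):s\in R^{\mathbb Z}\}$. It is correlation-free if $V'=\{0\}$. Restriction: if $i:Q'\to Q$ is injective, $I$ is its cell-by-cell extension and $F(I(Q'^{\mathbb Z}),R^{\mathbb Z})\subseteq I(Q'^{\mathbb Z})$, the $i$-restriction of $\mathcal A$ is the stochastic CA with states $Q'$, the same $R,V,V'$ and explicit global function $(c,s)\mapsto I^{-1}(F(I(c),s))$.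 Projection: if $\pi:Q\to Q'$ is surjective, $\Pi$ is its cell-by-cell extension and $\Pi(F(c,s))=\Pi(F(c',s))$ whenever $\Pi(c)=\Pi(c')$, the $\pi$-projection of $\mathcal A$ is the stochastic CA with states $Q'$, the same $R,V,V'$ and explicit global function $(\Pi(c),s)\mapsto\Pi(F(c,s))$. Rescaling: for $m,t\ge1$ and $z\in\mathbb Z$, $\mathcal A^{\langle m,t,z\rangle}$ is the stochastic CA with states $Q^m$, random symbols $(R^m)^t$ and explicit global function $$(c,s)\mapsto b_m\circ\sigma_z\circ F^t\bigl(b_m^{-1}(c),b_m^{-1}(s^1),\dots,b_m^{-1}(s^t)\bigr),$$ where $b_m(c)_x=(c_{mx},\dots,c_{mx+m-1})$, $\sigma_z(c)_x=c_{x+z}$, and $s^1,\dots,s^t\in(R^m)^{\mathbb Z}$ are the components of $s$. Write $\mathcal A_1\preccurlyeq^N_i\mathcal A_2$ (resp. $\mathcal A_1\preccurlyeq^N_m\mathcal A_2$) if there are $m_1,m_2,t_1,t_2\ge1$ and $z_1,z_2\in\mathbb Z$ such that the non-deterministic global function of $\mathcal A_1^{\langle m_1,t_1,z_1\rangle}$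 equals that of some restriction (resp. of some projection of some restriction) of $\mathcal A_2^{\langle m_2,t_2,z_2\rangle}$. **Theorem.** There exists a correlation-free stochastic CA $\mathcal U$ that is universal for both pre-orders: for every stochastic CA $\mathcal B$, $\mathcal B\preccurlyeq^N_i\mathcal U$ and $\mathcal B\preccurlyeq^N_m\mathcal U$. -/

import Mathlib

set_option linter.checkUnivs false

universe u v w x

/-- A one-dimensional stochastic cellular automaton `(Q, R, V, V', f)`: finite non-empty sets of
states `Q` and of random symbols `R`, two finite neighborhoods `V, V' ⊆ ℤ`, and a local transition
function `f : Q^V × R^V' → Q` (tuples are indexed by the elements of the neighborhoods). -/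
structure StochasticCA where
  Q : Type u
  R : Type v
  finite_Q : Finite Q
  nonempty_Q : Nonempty Q
  finite_R : Finite R
  nonempty_R : Nonempty R
  V : Finset ℤ
  V' : Finset ℤ
  f : (V → Q) → (V' → R) → Q

namespace StochasticCA

attribute [instance] finite_Q nonempty_Q finite_R nonempty_R

/-- Correlation-free: each cell uses its own random symbol only. -/
def IsCorrelationFree (A : StochasticCA.{u, v}) : Prop := A.V' = {0}

/-- The explicit global function `F : Q^ℤ × R^ℤ → Q^ℤ`. -/
def globalFun (A : StochasticCA.{u, v}) (c : ℤ → A.Q) (s : ℤ → A.R) : ℤ → A.Q :=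
  fun z => A.f (fun a => c (z + a)) (fun b => s (z + b))

/-- The iterates `F^t(c, s¹, …, sᵗ)`; the `R`-configuration `s^{k+1}` is `s k`. -/
def iterFun (A : StochasticCA.{u, v}) :
    (t : ℕ) → (ℤ → A.Q) → (Fin t → ℤ → A.R) → (ℤ → A.Q)
  | 0, c, _ => c
  | t + 1, c, s => A.globalFun (A.iterFun t c (fun k => s k.castSucc)) (s (Fin.last t))

/-- The non-deterministic global function `c ↦ {F(c,s) : s ∈ R^ℤ}`. -/
def ndet (A : StochasticCA.{u, v}) (c : ℤ → A.Q) : Set (ℤ → A.Q) :=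
  {d | ∃ s : ℤ → A.R, A.globalFun c s = d}

/-! ### Restrictions and projections -/

/-- `(i(Q'))^ℤ` is stable under `F`, whatever the `R`-configuration. -/
def IsStable (A : StochasticCA.{u, v}) {Q' : Type w} (i : Q' → A.Q) : Prop :=
  ∀ (c : ℤ → A.Q) (s : ℤ → A.R), (∀ z, c z ∈ Set.range i) → ∀ z, A.globalFun c s z ∈ Set.range i

/-- `π` is `F`-compatible. -/
def IsCompatible (A : StochasticCA.{u, v}) {Q' : Type w} (π : A.Q → Q') : Prop :=
  ∀ (s : ℤ → A.R) (c c' : ℤ → A.Q), π ∘ c = π ∘ c' → π ∘ A.globalFun c s = π ∘ A.globalFun c' s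

/-- The `i`-restriction of `A`, for `i` injective with `(i(Q'))^ℤ` stable; its explicit global
function is described by `restrict_globalFun`. -/
noncomputable def restrict (A : StochasticCA.{u, v}) {Q' : Type w} [Nonempty Q'] (i : Q' → A.Q)
    (hi : Function.Injective i) (_hs : A.IsStable i) : StochasticCA.{w, v} where
  Q := Q'
  R := A.R
  finite_Q := Finite.of_injective i hi
  nonempty_Q := inferInstance
  finite_R := inferInstance
  nonempty_R := inferInstance
  V := A.V
  V' := A.V'
  f := fun d e => Function.invFun i (A.f (fun a => i (d a)) e)

theorem restrict_globalFun (A : StochasticCA.{u, v}) {Q' : Type w} [Nonempty Q'] (i : Q' → A.Q)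
    (hi : Function.Injective i) (hs : A.IsStable i) (c : ℤ → Q') (s : ℤ → A.R) :
    i ∘ (A.restrict i hi hs).globalFun c s = A.globalFun (i ∘ c) s := by
  funext z
  exact Function.invFun_eq (hs (i ∘ c) s (fun z => ⟨c z, rfl⟩) z)

/-- The `π`-projection of `A`, for `π` surjective and compatible; its explicit global function is
described by `project_globalFun`. -/
noncomputable def project (A : StochasticCA.{u, v}) {Q' : Type w} (π : A.Q → Q')
    (hπ : Function.Surjective π) (_hc : A.IsCompatible π) : StochasticCA.{w, v} where
  Q := Q'
  R := A.R
  finite_Q := Finite.of_surjective π hπ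
  nonempty_Q := A.nonempty_Q.map π
  finite_R := inferInstance
  nonempty_R := inferInstance
  V := A.V
  V' := A.V'
  f := fun d e => π (A.f (fun a => Function.surjInv hπ (d a)) e)

theorem project_globalFun (A : StochasticCA.{u, v}) {Q' : Type w} (π : A.Q → Q')
    (hπ : Function.Surjective π) (hc : A.IsCompatible π) (c : ℤ → A.Q) (s : ℤ → A.R) :
    (A.project π hπ hc).globalFun (π ∘ c) s = π ∘ A.globalFun c s := by
  have h : π ∘ (fun z => Function.surjInv hπ (π (c z))) = π ∘ c := by
    funext z
    exact Function.surjInv_eq hπ (π (c z))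
  rw [← hc s _ _ h]
  rfl

/-- `A₁` is a non-deterministic subautomaton of `A₂`: the non-deterministic global function of
`A₁` is that of some restriction of `A₂`. -/
def NSub (A₁ : StochasticCA.{u, v}) (A₂ : StochasticCA.{w, x}) : Prop :=
  ∃ (i : A₁.Q → A₂.Q) (hi : Function.Injective i) (hs : A₂.IsStable i),
    A₁.ndet = (A₂.restrict i hi hs).ndet

/-- The mixed relation: the non-deterministic global function of `A₁` is that of some projection
of some restriction of `A₂`. -/
def NMix (A₁ : StochasticCA.{u, v}) (A₂ : StochasticCA.{w, x}) : Prop :=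
  ∃ (Q' : Type w) (_ : Nonempty Q') (i : Q' → A₂.Q) (hi : Function.Injective i)
    (hs : A₂.IsStable i) (π : Q' → A₁.Q) (hπ : Function.Surjective π)
    (hc : (A₂.restrict i hi hs).IsCompatible π),
    A₁.ndet = ((A₂.restrict i hi hs).project π hπ hc).ndet

/-! ### Rescaling -/

/-- The translation `σ_z`. -/
def shift {S : Type w} (z : ℤ) (c : ℤ → S) : ℤ → S := fun z' => c (z' + z)

/-- The packing map `b_m : S^ℤ → (S^m)^ℤ`. -/
def pack {S : Type w} (m : ℕ+) (c : ℤ → S) : ℤ → (Fin m → S) :=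
  fun z j => c ((m : ℤ) * z + (j : ℤ))

/-- The inverse of the packing map. -/
def unpack {S : Type w} (m : ℕ+) (d : ℤ → (Fin m → S)) : ℤ → S :=
  fun y => d (y / (m : ℤ)) ⟨(y % (m : ℤ)).toNat, by
    have h0 : (0 : ℤ) < (m : ℤ) := by exact_mod_cast m.pos
    have h1 := Int.emod_nonneg y h0.ne'
    have h2 := Int.emod_lt_of_pos y h0
    omega⟩

theorem unpack_pack {S : Type w} (m : ℕ+) (c : ℤ → S) : unpack m (pack m c) = c := by
  funext y
  have h0 : (0 : ℤ) < (m : ℤ) := by exact_mod_cast m.pos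
  have h1 := Int.emod_nonneg y h0.ne'
  have h2 := Int.mul_ediv_add_emod y (m : ℤ)
  simp only [unpack, pack]
  congr 1
  rw [Int.toNat_of_nonneg h1, h2]

theorem pack_unpack {S : Type w} (m : ℕ+) (d : ℤ → (Fin m → S)) : pack m (unpack m d) = d := by
  funext z j
  have h0 : (0 : ℤ) < (m : ℤ) := by exact_mod_cast m.pos
  have hj0 : (0 : ℤ) ≤ (j : ℤ) := by positivity
  have hj : ((j : ℕ) : ℤ) < (m : ℤ) := by exact_mod_cast j.2
  have h1 : ((m : ℤ) * z + (j : ℤ)) / (m : ℤ) = z := by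
    rw [Int.add_comm, Int.add_mul_ediv_left _ _ h0.ne', Int.ediv_eq_zero_of_lt hj0 hj, zero_add]
  have h2 : ((m : ℤ) * z + (j : ℤ)) % (m : ℤ) = j := by
    rw [Int.add_comm, Int.add_mul_emod_self_left, Int.emod_eq_of_lt hj0 hj]
  simp only [pack, unpack, h1]
  congr 1
  apply Fin.ext
  simp [h2]

/-- The explicit global function of the rescaling of `A` with parameters `(m, t, z)`:
`b_m ∘ σ_z ∘ F^t (b_m⁻¹ c, b_m⁻¹ s¹, …, b_m⁻¹ sᵗ)`. -/
def rescaleFun (A : StochasticCA.{u, v}) (m t : ℕ+) (z : ℤ)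
    (c : ℤ → (Fin m → A.Q)) (s : ℤ → (Fin t → Fin m → A.R)) : ℤ → (Fin m → A.Q) :=
  pack m (shift z (A.iterFun t (unpack m c) (fun k => unpack m (fun j => s j k))))

/-- The cells of the initial configuration on which cell `0` depends after `t` steps. -/
def reach (V : Finset ℤ) : ℕ → Finset ℤ
  | 0 => {0}
  | t + 1 => V.biUnion fun a => (reach V t).image fun y => a + y

/-- The cells of the `R`-configurations on which cell `0` depends after `t` steps. -/
def randReach (V V' : Finset ℤ) : ℕ → Finset ℤ
  | 0 => ∅
  | t + 1 => V' ∪ V.biUnion fun a => (randReach V V' t).image fun y => a + y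

/-- The blocks that contain one of the cells `z + j + y`, `0 ≤ j < m`, `y ∈ N`. -/
def blockNbhd (m : ℕ+) (z : ℤ) (N : Finset ℤ) : Finset ℤ :=
  (Finset.univ : Finset (Fin m)).biUnion fun j => N.image fun y => ((j : ℤ) + z + y) / (m : ℤ)

/-- Any extension of a tuple indexed by a finite subset of `ℤ` to a configuration. -/
noncomputable def extend {S : Type w} [Nonempty S] {N : Finset ℤ} (d : N → S) : ℤ → S :=
  fun y => if h : y ∈ N then d ⟨y, h⟩ else Classical.arbitrary S

/-- The rescaling of `A` with parameters `(m, t, z)`, with state set `Q^m` and random symbols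
`(R^m)^t`; its explicit global function is `rescaleFun`, see `rescale_globalFun`. -/
noncomputable def rescale (A : StochasticCA.{u, v}) (m t : ℕ+) (z : ℤ) : StochasticCA.{u, v} where
  Q := Fin m → A.Q
  R := Fin t → Fin m → A.R
  finite_Q := inferInstance
  nonempty_Q := inferInstance
  finite_R := inferInstance
  nonempty_R := inferInstance
  V := blockNbhd m z (reach A.V t)
  V' := blockNbhd m z (randReach A.V A.V' t)
  f := fun d e => A.rescaleFun m t z (extend d) (extend e) 0

theorem iterFun_shift (A : StochasticCA.{u, v}) (z : ℤ) (t : ℕ) :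
    ∀ (c : ℤ → A.Q) (s : Fin t → ℤ → A.R),
      A.iterFun t (shift z c) (fun k => shift z (s k)) = shift z (A.iterFun t c s) := by
  induction t with
  | zero => intro c s; rfl
  | succ t ih =>
    intro c s
    simp only [iterFun]
    rw [ih c (fun k => s k.castSucc)]
    funext y
    simp only [globalFun, shift]
    congr 1 <;> funext a <;> congr 1 <;> ring

theorem iterFun_local (A : StochasticCA.{u, v}) (t : ℕ) :
    ∀ (c c' : ℤ → A.Q) (s s' : Fin t → ℤ → A.R) (y : ℤ),
      (∀ a ∈ reach A.V t, c (y + a) = c' (y + a)) →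
      (∀ k, ∀ b ∈ randReach A.V A.V' t, s k (y + b) = s' k (y + b)) →
      A.iterFun t c s y = A.iterFun t c' s' y := by
  induction t with
  | zero =>
    intro c c' s s' y hc _
    simpa [iterFun, reach] using hc
  | succ t ih =>
    intro c c' s s' y hc hs
    simp only [iterFun, globalFun]
    congr 1
    · funext a
      apply ih
      · intro a' ha'
        rw [add_assoc]
        apply hc
        simp only [reach, Finset.mem_biUnion, Finset.mem_image]
        exact ⟨a, a.2, a', ha', rfl⟩
      · intro k b hb
        rw [add_assoc]
        apply hs
        simp only [randReach, Finset.mem_union, Finset.mem_biUnion, Finset.mem_image]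
        exact Or.inr ⟨a, a.2, b, hb, rfl⟩
    · funext b
      apply hs
      simp only [randReach, Finset.mem_union]
      exact Or.inl b.2

theorem unpack_shift {S : Type w} (m : ℕ+) (y : ℤ) (d : ℤ → (Fin m → S)) :
    unpack m (shift y d) = shift ((m : ℤ) * y) (unpack m d) := by
  have h : shift y d = pack m (shift ((m : ℤ) * y) (unpack m d)) := by
    conv_lhs => rw [← pack_unpack m d]
    funext z j
    simp only [shift, pack]
    congr 1
    ring
  rw [h, unpack_pack]

theorem rescale_globalFun (A : StochasticCA.{u, v}) (m t : ℕ+) (z : ℤ)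
    (c : ℤ → (Fin m → A.Q)) (s : ℤ → (Fin t → Fin m → A.R)) :
    (A.rescale m t z).globalFun c s = A.rescaleFun m t z c s := by
  funext y j
  have hshift : A.rescaleFun m t z c s y j = A.rescaleFun m t z (shift y c) (shift y s) 0 j := by
    simp only [rescaleFun]
    rw [unpack_shift m y c]
    have : (fun k : Fin t => unpack m (fun j => shift y s j k)) =
        fun k => shift ((m : ℤ) * y) (unpack m (fun j => s j k)) := by
      funext k
      exact unpack_shift m y (fun j => s j k)
    rw [this, iterFun_shift]
    simp only [pack, shift]
    congr 1
    ring
  rw [hshift]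
  simp only [globalFun, rescale, rescaleFun, pack, shift]
  apply iterFun_local
  · intro a ha
    have hm : ((m : ℤ) * 0 + (j : ℤ) + z + a) / (m : ℤ) ∈ blockNbhd m z (reach A.V t) := by
      simp only [blockNbhd, Finset.mem_biUnion, Finset.mem_image, Finset.mem_univ, true_and]
      exact ⟨j, a, ha, by ring_nf⟩
    simp only [unpack, extend, hm, dif_pos, add_comm y]
    rfl
  · intro k b hb
    have hm : ((m : ℤ) * 0 + (j : ℤ) + z + b) / (m : ℤ) ∈
        blockNbhd m z (randReach A.V A.V' t) := by
      simp only [blockNbhd, Finset.mem_biUnion, Finset.mem_image, Finset.mem_univ, true_and]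
      exact ⟨j, b, hb, by ring_nf⟩
    simp only [unpack, extend, hm, dif_pos, add_comm y]

/-! ### Simulation pre-orders and universality -/

/-- The non-deterministic injective simulation relation: `A₂` simulates `A₁`. -/
def NSimInj (A₁ : StochasticCA.{u, v}) (A₂ : StochasticCA.{w, x}) : Prop :=
  ∃ (m₁ m₂ t₁ t₂ : ℕ+) (z₁ z₂ : ℤ), NSub (A₁.rescale m₁ t₁ z₁) (A₂.rescale m₂ t₂ z₂)

/-- The non-deterministic mixed simulation relation: `A₂` simulates `A₁`. -/
def NSimMix (A₁ : StochasticCA.{u, v}) (A₂ : StochasticCA.{w, x}) : Prop :=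
  ∃ (m₁ m₂ t₁ t₂ : ℕ+) (z₁ z₂ : ℤ), NMix (A₁.rescale m₁ t₁ z₁) (A₂.rescale m₂ t₂ z₂)

/-- `U` is universal for the simulation relation `sim`: it simulates every stochastic CA. -/
def IsUniversal (sim : StochasticCA.{u, v} → StochasticCA.{w, x} → Prop)
    (U : StochasticCA.{w, x}) : Prop :=
  ∀ B : StochasticCA.{u, v}, sim B U

end StochasticCA

/-!
The universal automaton is `sweepCA`. Its configurations are a superposition of three layers: a
static memory, accumulators moving right by one cell per step, and a program (a tape of letters)
moving left by one cell per step. An accumulator acts only when it meets a memory cell, and what it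
does is prescribed by the letter present at the meeting point.

Fix a word length `n` and a table of `K` entries `(u, u', v)`. A configuration is cut into blocks of
`2 * n * K` cells. The first `n` cells of each block are memory cells and hold one word; the
accumulators start at the multiples of `2 * n`, so that each block is crossed by `K` of them during
each period of `2 * n * K` steps. Accumulators and program having opposite unit speeds, the `κ`-th
accumulator crossing a block meets its `j`-th memory cell always in front of the letter of index
`2 * n * κ + 2 * j`, whatever the block: this is the letter `j` of the entry `κ mod K`
(`encode_letter_visit`). Hence each accumulator is devoted to one entry of the table, and in
successive periods it crosses successive blocks. It goes through four phases, one per block: in the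
first block it redraws the random part of the word, in the second it compares the word with `u`, in
the third it compares the word with `u'`, in the fourth it writes `v` if both comparisons
succeeded. All accumulators are in the same phase during a period, so no word is modified between
the draws and the writings. If the table is the graph of a function `G`, exactly one accumulator
succeeds for each pair of consecutive blocks, and four periods apply `G` to all pairs of consecutive
words, up to a translation by two blocks, and restore the accumulators and the program
(`sweep_encode`, `exists_sweepCA_simulation`). The random part of a word after the first phase
consists of the symbols read in the last draw, so it can be anything.

An arbitrary stochastic CA becomes, after packing cells into large blocks and a translation, one in
which a cell depends only on the states and random symbols of itself and its right neighbor
(`exists_rescale_two_cells`). Coding the states injectively by binary words, and the random symbols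
by a surjection from binary words, its local function becomes such a function `G`. Only the set of
reachable images matters, so the surjection need not preserve probabilities. Finally a
non-deterministic subautomaton is in particular a projection of a restriction (`NSub.nMix`).
-/

/-! ### The sweep automaton -/

namespace StochasticCA

/-- A letter of the program: the part of an entry `(u, u', v)` of the table that concerns one memory
cell. `fst`, `snd` are the symbols of `u`, `u'`, and `out` that of `v`; `last` marks the last letter
of each entry. -/
structure Letter where
  fst : Bool × Bool
  snd : Bool × Bool
  out : Bool
  last : Bool

/-- A state of the sweep automaton. `isMem` and `mem` (a pair of a data bit and a random bit) form
the static layer; `isAcc`, `phase` and `ok` form the layer of accumulators moving right; `letter`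
moves left. The other fields of a layer are inert where `isMem`, resp. `isAcc`, is false. -/
structure Cell where
  isMem : Bool
  isAcc : Bool
  mem : Bool × Bool
  phase : Fin 4
  ok : Bool
  letter : Letter

instance : Finite Letter :=
  Finite.of_injective (fun l : Letter => (l.fst, l.snd, l.out, l.last)) fun a b h => by
    cases a; cases b; simp_all

instance : Finite Cell :=
  Finite.of_injective (fun q : Cell => (q.isMem, q.isAcc, q.mem, q.phase, q.ok, q.letter))
    fun a b h => by cases a; cases b; simp_all

instance : Nonempty Cell :=
  ⟨⟨false, false, (false, false), 0, false, ⟨(false, false), (false, false), false, false⟩⟩⟩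

namespace Cell

/-- The memory after the step, given the random symbol of the cell: an accumulator redraws the
random bit in phase `0`, and in phase `3` it writes, clearing the random bit, if it is `ok`. -/
def newMem (q : Cell) (r : Bool) : Bool × Bool :=
  if q.isMem ∧ q.isAcc then
    if q.phase = 0 then (q.mem.1, r)
    else if q.phase = 3 ∧ q.ok then (q.letter.out, false)
    else q.mem
  else q.mem

/-- The phase of the accumulator leaving the cell: the phase increases, cyclically, after the last
memory cell of a block. -/
def newPhase (q : Cell) : Fin 4 :=
  if q.isMem ∧ q.isAcc ∧ q.letter.last then q.phase + 1 else q.phase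

/-- The flag `ok` of the accumulator leaving the cell: it records whether all comparisons of phases
`1` and `2` have succeeded so far, and is reset at the end of phase `3`. -/
def newOk (q : Cell) : Bool :=
  if q.isMem ∧ q.isAcc then
    if q.phase = 1 then q.ok && decide (q.mem = q.letter.fst)
    else if q.phase = 2 then q.ok && decide (q.mem = q.letter.snd)
    else if q.phase = 3 ∧ q.letter.last then true
    else q.ok
  else q.ok

end Cell

/-- The universal automaton. The random symbol of a cell is used only to redraw its own random bit,
so the automaton is correlation-free. -/
def sweepCA : StochasticCA.{0, 0} where
  Q := Cell
  R := Bool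
  finite_Q := inferInstance
  nonempty_Q := inferInstance
  finite_R := inferInstance
  nonempty_R := inferInstance
  V := {-1, 0, 1}
  V' := {0}
  f := fun d e =>
    { isMem := (d ⟨0, by simp⟩).isMem
      isAcc := (d ⟨-1, by simp⟩).isAcc
      mem := (d ⟨0, by simp⟩).newMem (e ⟨0, by simp⟩)
      phase := (d ⟨-1, by simp⟩).newPhase
      ok := (d ⟨-1, by simp⟩).newOk
      letter := (d ⟨1, by simp⟩).letter }

/-- The configuration of `sweepCA` at time `t`, started from `c` with random symbols `r`. -/
def sweep (c : ℤ → Cell) (r : ℕ → ℤ → Bool) (t : ℕ) : ℤ → Cell :=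
  sweepCA.iterFun t c fun k => r k

section Evolution

variable (c : ℤ → Cell) (r : ℕ → ℤ → Bool)

theorem sweep_succ (t : ℕ) (x : ℤ) :
    sweep c r (t + 1) x =
      { isMem := (sweep c r t x).isMem
        isAcc := (sweep c r t (x - 1)).isAcc
        mem := (sweep c r t x).newMem (r t x)
        phase := (sweep c r t (x - 1)).newPhase
        ok := (sweep c r t (x - 1)).newOk
        letter := (sweep c r t (x + 1)).letter } := by
  have h : sweep c r (t + 1) x = sweepCA.globalFun (sweep c r t) (r t) x := rfl
  rw [h]
  simp only [globalFun, sweepCA, add_zero, Int.reduceNeg, ← sub_eq_add_neg]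

theorem sweep_zero : sweep c r 0 = c := rfl

theorem sweep_isMem (t : ℕ) (x : ℤ) : (sweep c r t x).isMem = (c x).isMem := by
  induction t with
  | zero => rfl
  | succ t ih => rw [sweep_succ]; exact ih

theorem sweep_isAcc (t : ℕ) (x : ℤ) : (sweep c r t x).isAcc = (c (x - t)).isAcc := by
  induction t generalizing x with
  | zero => simp [sweep_zero]
  | succ t ih => rw [sweep_succ]; simp only [ih]; congr 2; push_cast; ring

theorem sweep_letter (t : ℕ) (x : ℤ) : (sweep c r t x).letter = (c (x + t)).letter := by
  induction t generalizing x with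
  | zero => simp [sweep_zero]
  | succ t ih => rw [sweep_succ]; simp only [ih]; congr 2; push_cast; ring

theorem sweep_mem_succ (t : ℕ) (x : ℤ) :
    (sweep c r (t + 1) x).mem = (sweep c r t x).newMem (r t x) := by rw [sweep_succ]

theorem sweep_phase_succ (t : ℕ) (x : ℤ) :
    (sweep c r (t + 1) (x + 1)).phase = (sweep c r t x).newPhase := by
  rw [sweep_succ]; simp

theorem sweep_ok_succ (t : ℕ) (x : ℤ) :
    (sweep c r (t + 1) (x + 1)).ok = (sweep c r t x).newOk := by
  rw [sweep_succ]; simp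

/-- The memory of a cell does not change while no accumulator meets it. -/
theorem sweep_mem_of_isAcc_eq_false (t d : ℕ) (x : ℤ)
    (h : ∀ i < d, (c (x - (t + i : ℕ))).isAcc = false) :
    (sweep c r (t + d) x).mem = (sweep c r t x).mem := by
  induction d with
  | zero => rfl
  | succ d ih =>
    rw [← add_assoc, sweep_mem_succ, Cell.newMem, sweep_isAcc, h d (Nat.lt_succ_self d)]
    simpa using ih fun i hi => h i (hi.trans (Nat.lt_succ_self d))

/-- An accumulator does not change while it meets no memory cell. -/
theorem sweep_acc_of_isMem_eq_false (t d : ℕ) (x : ℤ)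
    (h : ∀ i < d, (c (x + (i : ℕ))).isMem = false) :
    (sweep c r (t + d) (x + d)).phase = (sweep c r t x).phase ∧
      (sweep c r (t + d) (x + d)).ok = (sweep c r t x).ok := by
  induction d with
  | zero => simp
  | succ d ih =>
    have h1 := h d (Nat.lt_succ_self d)
    obtain ⟨h2, h3⟩ := ih fun i hi => h i (hi.trans (Nat.lt_succ_self d))
    rw [← add_assoc, Nat.cast_succ, ← add_assoc, sweep_phase_succ, sweep_ok_succ, Cell.newPhase,
      Cell.newOk, sweep_isMem, h1]
    simpa using ⟨h2, h3⟩

theorem sweep_acc_of_isAcc_eq_false (t : ℕ) (x : ℤ) (h : (c x).isAcc = false) :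
    (sweep c r t (x + t)).phase = (c x).phase ∧ (sweep c r t (x + t)).ok = (c x).ok := by
  induction t with
  | zero => simp [sweep_zero]
  | succ t ih =>
    rw [Nat.cast_succ, ← add_assoc, sweep_phase_succ, sweep_ok_succ, Cell.newPhase,
      Cell.newOk, sweep_isAcc, add_sub_cancel_right, h]
    simpa using ih

theorem sweep_mem_of_isMem_eq_false (t : ℕ) (x : ℤ) (h : (c x).isMem = false) :
    (sweep c r t x).mem = (c x).mem := by
  induction t with
  | zero => rfl
  | succ t ih =>
    rw [sweep_mem_succ, Cell.newMem, sweep_isMem, h]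
    simpa using ih

end Evolution

/-! ### Meetings of accumulators and memory cells -/

/-- The configuration coding the words `c X`, `X : ℤ`, of length `n` (values at `j ≥ n` are unused),
with the program given by `L k j`, `k < K`, `j < n`. Letter `j` of entry `k` is at position
`2 * n * k + 2 * j` of each block (and at the next position, where it is never read). -/
def encode (n K : ℕ) (L : ℕ → ℕ → Letter) (c : ℤ → ℕ → Bool) (x : ℤ) : Cell where
  isMem := decide (x % (2 * n * K : ℕ) < n)
  isAcc := decide (((2 * n : ℕ) : ℤ) ∣ x)
  mem := if x % (2 * n * K : ℕ) < n then
    (c (x / (2 * n * K : ℕ)) (x % (2 * n * K : ℕ)).toNat, false) else (false, false)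
  phase := 0
  ok := true
  letter := L ((x % (2 * n * K : ℕ)).toNat / (2 * n)) ((x % (2 * n * K : ℕ)).toNat % (2 * n) / 2)

theorem emod_block {m j : ℕ} (X : ℤ) (hj : j < m) : ((m : ℤ) * X + j) % m = j := by
  rw [add_comm, Int.add_mul_emod_self_left, Int.emod_eq_of_lt (by positivity)
    (by exact_mod_cast hj)]

theorem ediv_block {m j : ℕ} (X : ℤ) (hj : j < m) : ((m : ℤ) * X + j) / m = X := by
  rw [add_comm, Int.add_mul_ediv_left _ _ (by omega),
    Int.ediv_eq_zero_of_lt (by positivity) (by exact_mod_cast hj), zero_add]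

section Visits

variable {n K : ℕ} (L : ℕ → ℕ → Letter) (c : ℤ → ℕ → Bool) (r : ℕ → ℤ → Bool)

theorem encode_isMem_block (X : ℤ) {j : ℕ} (hj : j < 2 * n * K) :
    (encode n K L c ((2 * n * K : ℕ) * X + j)).isMem = decide (j < n) := by
  simp only [encode, emod_block X hj, Nat.cast_lt]

theorem encode_letter_visit (hn : 0 < n) (hK : 0 < K) (X : ℤ) (κ : ℕ) {j : ℕ} (hj : j < n) :
    (encode n K L c ((2 * n * K : ℕ) * X + j + (2 * n * κ + j : ℕ))).letter = L (κ % K) j := by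
  have h1 : ((2 * n * K : ℕ) * X + j + (2 * n * κ + j : ℕ) : ℤ) =
      (2 * n * K : ℕ) * (X + (κ / K : ℕ)) + (2 * n * (κ % K) + 2 * j : ℕ) := by
    have := Nat.div_add_mod κ K
    zify at this
    push_cast
    linear_combination (-2 * (n : ℤ)) * this
  have h3 : κ % K < K := Nat.mod_lt _ hK
  have h2 : 2 * n * (κ % K) + 2 * j < 2 * n * K := by nlinarith
  simp only [encode, h1, emod_block _ h2, Int.toNat_natCast]
  congr 1
  · rw [Nat.mul_add_div (by omega), Nat.div_eq_of_lt (by omega), add_zero]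
  · rw [Nat.mul_add_mod, Nat.mod_eq_of_lt (by omega)]
    omega

/-- The state of the `j`-th memory cell of block `X` when the `κ`-th accumulator to cross this block
meets it, counting `κ` from `0` at time `0`. For `j = n` its accumulator fields are those of the
accumulator that has just left the memory of the block. -/
def visit (n K : ℕ) (L : ℕ → ℕ → Letter) (c : ℤ → ℕ → Bool) (r : ℕ → ℤ → Bool)
    (X : ℤ) (κ j : ℕ) : Cell :=
  sweep (encode n K L c) r (2 * n * κ + j) ((2 * n * K : ℕ) * X + j)

theorem lt_block (hK : 0 < K) {j : ℕ} (hj : j < 2 * n) : j < 2 * n * K := by nlinarith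

theorem visit_isMem (hK : 0 < K) (X : ℤ) (κ : ℕ) {j : ℕ} (hj : j < n) :
    (visit n K L c r X κ j).isMem = true := by
  rw [visit, sweep_isMem, encode_isMem_block _ _ _ (lt_block hK (by omega))]
  simpa using hj

theorem visit_isAcc (X : ℤ) (κ j : ℕ) : (visit n K L c r X κ j).isAcc = true := by
  rw [visit, sweep_isAcc]
  simp only [encode, decide_eq_true_eq]
  refine ⟨K * X - κ, ?_⟩
  push_cast
  ring

theorem visit_letter (hn : 0 < n) (hK : 0 < K) (X : ℤ) (κ : ℕ) {j : ℕ} (hj : j < n) :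
    (visit n K L c r X κ j).letter = L (κ % K) j := by
  rw [visit, sweep_letter, encode_letter_visit _ _ hn hK _ _ hj]

theorem visit_phase_succ (X : ℤ) (κ j : ℕ) :
    (visit n K L c r X κ (j + 1)).phase = (visit n K L c r X κ j).newPhase := by
  rw [visit, visit, ← sweep_phase_succ, Nat.cast_succ, ← add_assoc, ← add_assoc]

theorem visit_ok_succ (X : ℤ) (κ j : ℕ) :
    (visit n K L c r X κ (j + 1)).ok = (visit n K L c r X κ j).newOk := by
  rw [visit, visit, ← sweep_ok_succ, Nat.cast_succ, ← add_assoc, ← add_assoc]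

/-- The `κ`-th accumulator of a block is the `κ + K`-th one of the next block, and it is unchanged
in between. -/
theorem visit_next_block (hK : 0 < K) (X : ℤ) (κ : ℕ) :
    (visit n K L c r (X + 1) (κ + K) 0).phase = (visit n K L c r X κ n).phase ∧
      (visit n K L c r (X + 1) (κ + K) 0).ok = (visit n K L c r X κ n).ok := by
  have hn : n ≤ 2 * n * K := by nlinarith
  have h := sweep_acc_of_isMem_eq_false (encode n K L c) r (2 * n * κ + n) (2 * n * K - n)
    ((2 * n * K : ℕ) * X + n) (fun i hi => by
      rw [add_assoc, ← Nat.cast_add, encode_isMem_block _ _ _ (by omega)]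
      simp)
  have e1 : 2 * n * κ + n + (2 * n * K - n) = 2 * n * (κ + K) + 0 := by
    rw [mul_add]; omega
  have e2 : ((2 * n * K : ℕ) * X + n + (2 * n * K - n : ℕ) : ℤ) =
      (2 * n * K : ℕ) * (X + 1) + (0 : ℕ) := by
    rw [Nat.cast_sub hn]; push_cast; ring
  rw [e1, e2] at h
  exact h

/-- Away from the multiples of `2 * n` there is no accumulator; the points are written
`2 * n * q - (i + 1)`. -/
theorem encode_isAcc_eq_false {N i : ℕ} {x : ℤ} (hN : N = 2 * n) (q : ℤ)
    (hx : x = N * q - (i + 1 : ℕ)) (hi : i + 1 < N) : (encode n K L c x).isAcc = false := by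
  subst hN
  simp only [encode, decide_eq_false_iff_not, hx]
  intro h
  have h2 : ((2 * n : ℕ) : ℤ) ∣ ((i + 1 : ℕ) : ℤ) := by
    have := (Dvd.intro q rfl : ((2 * n : ℕ) : ℤ) ∣ (2 * n : ℕ) * q).sub h
    simpa using this
  exact absurd (Nat.le_of_dvd (by omega) (Int.natCast_dvd_natCast.1 h2)) (by omega)

theorem visit_mem_succ (hn : 0 < n) (X : ℤ) (κ j : ℕ) :
    (visit n K L c r X (κ + 1) j).mem =
      (visit n K L c r X κ j).newMem (r (2 * n * κ + j) ((2 * n * K : ℕ) * X + j)) := by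
  rw [visit, visit, ← sweep_mem_succ]
  have e : 2 * n * (κ + 1) + j = 2 * n * κ + j + 1 + (2 * n - 1) := by
    rw [mul_add]; omega
  rw [e]
  refine sweep_mem_of_isAcc_eq_false _ _ _ _ _ fun i hi => ?_
  refine encode_isAcc_eq_false L c (N := 2 * n) (i := i) rfl (K * X - κ) ?_ (by omega)
  push_cast
  ring

theorem visit_mem_zero (hK : 0 < K) (X : ℤ) {j : ℕ} (hj : j < n) :
    (visit n K L c r X 0 j).mem = (c X j, false) := by
  have h := sweep_mem_of_isAcc_eq_false (encode n K L c) r 0 j ((2 * n * K : ℕ) * X + j)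
    (fun i hi => encode_isAcc_eq_false L c (N := 2 * n) (i := 2 * n - (j - i) - 1) rfl
      (K * X + 1) (by
        have : 2 * n - (j - i) - 1 + 1 = 2 * n - (j - i) := by omega
        rw [this, Nat.cast_sub (by omega), Nat.cast_sub (by omega)]
        push_cast
        ring) (by omega))
  have hj' := lt_block hK (show j < 2 * n by omega)
  rw [visit, mul_zero, h, sweep_zero]
  simp only [encode, emod_block X hj', ediv_block X hj', Nat.cast_lt, hj, if_true,
    Int.toNat_natCast]

theorem encode_isMem_before_block (X : ℤ) {k i : ℕ} (hk : k < K) (hi : i < 2 * n * k) :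
    (encode n K L c ((2 * n * K : ℕ) * X - (2 * n * k : ℕ) + i)).isMem = false := by
  have h1 : 2 * n * k ≤ 2 * n * K := Nat.mul_le_mul_left _ hk.le
  have h2 : 2 * n * (k + 1) ≤ 2 * n * K := Nat.mul_le_mul_left _ hk
  rw [mul_add] at h2
  have e : ((2 * n * K : ℕ) * X - (2 * n * k : ℕ) + i : ℤ) =
      (2 * n * K : ℕ) * (X - 1) + (2 * n * K - 2 * n * k + i : ℕ) := by
    push_cast [Nat.cast_sub h1]; ring
  rw [e, encode_isMem_block _ _ _ (by omega)]
  simp only [decide_eq_false_iff_not]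
  omega

/-- The accumulator layer reaches block `X` unchanged from fewer than `K` intervals of length `2 * n`
before it, where there is no memory. -/
theorem sweep_acc_before_block (t : ℕ) (X : ℤ) {k : ℕ} (hk : k < K) :
    (sweep (encode n K L c) r (t + 2 * n * k) ((2 * n * K : ℕ) * X)).phase =
        (sweep (encode n K L c) r t ((2 * n * K : ℕ) * X - (2 * n * k : ℕ))).phase ∧
      (sweep (encode n K L c) r (t + 2 * n * k) ((2 * n * K : ℕ) * X)).ok =
        (sweep (encode n K L c) r t ((2 * n * K : ℕ) * X - (2 * n * k : ℕ))).ok := by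
  have h := sweep_acc_of_isMem_eq_false (encode n K L c) r t (2 * n * k)
    ((2 * n * K : ℕ) * X - (2 * n * k : ℕ)) fun i hi => encode_isMem_before_block L c X hk hi
  rwa [sub_add_cancel] at h

theorem visit_acc_zero (X : ℤ) {k : ℕ} (hk : k < K) :
    (visit n K L c r X k 0).phase = 0 ∧ (visit n K L c r X k 0).ok = true := by
  have h := sweep_acc_before_block (n := n) L c r 0 X hk
  rw [zero_add] at h
  simpa [visit, sweep_zero, encode] using h

end Visits
/-! ### The four phases -/

section Phases

variable {n K : ℕ} (L : ℕ → ℕ → Letter) (c : ℤ → ℕ → Bool) (r : ℕ → ℤ → Bool)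

/-- The memory of block `X` after phase `0`: the random bits are those of the last of the `K` draws,
made by the accumulator `K - 1`. -/
def drawn (n K : ℕ) (c : ℤ → ℕ → Bool) (r : ℕ → ℤ → Bool) (X : ℤ) (j : ℕ) : Bool × Bool :=
  (c X j, r (2 * n * (K - 1) + j) ((2 * n * K : ℕ) * X + j))

theorem visit_ok_start_succ (hK : 0 < K) (ρ : ℕ) (X : ℤ) (k : ℕ) :
    (visit n K L c r X ((ρ + 1) * K + k) 0).ok = (visit n K L c r (X - 1) (ρ * K + k) n).ok := by
  have h := (visit_next_block L c r hK (n := n) (X - 1) (ρ * K + k)).2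
  rw [sub_add_cancel] at h
  rw [← h, show (ρ + 1) * K + k = ρ * K + k + K by ring]

variable (hn : 0 < n) (hK : 0 < K) (hL : ∀ k j, (L k j).last = decide (j + 1 = n))

include hn hK hL

theorem visit_phase_of_start (X : ℤ) (κ : ℕ) {j : ℕ} (hj : j < n) :
    (visit n K L c r X κ j).phase = (visit n K L c r X κ 0).phase := by
  induction j with
  | zero => rfl
  | succ j ih =>
    rw [visit_phase_succ, Cell.newPhase, visit_letter _ _ _ hn hK _ _ (by omega), hL,
      decide_eq_false (by omega)]
    simpa using ih (by omega)

theorem visit_phase_end (X : ℤ) (κ : ℕ) :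
    (visit n K L c r X κ n).phase = (visit n K L c r X κ 0).phase + 1 := by
  obtain ⟨j, rfl⟩ : ∃ j, n = j + 1 := ⟨n - 1, by omega⟩
  rw [visit_phase_succ, Cell.newPhase, visit_letter _ _ _ hn hK _ _ (by omega), hL,
    visit_isMem _ _ _ hK _ _ (by omega), visit_isAcc,
    visit_phase_of_start L c r hn hK hL _ _ (by omega)]
  simp

theorem visit_phase_start (ρ : ℕ) (X : ℤ) {k : ℕ} (hk : k < K) :
    (visit n K L c r X (ρ * K + k) 0).phase = Fin.ofNat 4 ρ := by
  induction ρ generalizing X with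
  | zero => simpa using (visit_acc_zero L c r X hk).1
  | succ ρ ih =>
    have h := (visit_next_block L c r hK (n := n) (X - 1) (ρ * K + k)).1
    rw [sub_add_cancel, visit_phase_end L c r hn hK hL, ih] at h
    rw [show (ρ + 1) * K + k = ρ * K + k + K by ring, h]
    ext
    simp [Fin.val_add]

theorem visit_phase (ρ : ℕ) (X : ℤ) {k j : ℕ} (hk : k < K) (hj : j < n) :
    (visit n K L c r X (ρ * K + k) j).phase = Fin.ofNat 4 ρ := by
  rw [visit_phase_of_start L c r hn hK hL _ _ hj, visit_phase_start L c r hn hK hL _ _ hk]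

theorem visit_ok_step (ρ : ℕ) (X : ℤ) {k j : ℕ} (hk : k < K) (hj : j < n) :
    (visit n K L c r X (ρ * K + k) (j + 1)).ok =
      if Fin.ofNat 4 ρ = 1 then (visit n K L c r X (ρ * K + k) j).ok &&
        decide ((visit n K L c r X (ρ * K + k) j).mem = (L k j).fst)
      else if Fin.ofNat 4 ρ = 2 then (visit n K L c r X (ρ * K + k) j).ok &&
        decide ((visit n K L c r X (ρ * K + k) j).mem = (L k j).snd)
      else if Fin.ofNat 4 ρ = 3 ∧ j + 1 = n then true
      else (visit n K L c r X (ρ * K + k) j).ok := by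
  rw [visit_ok_succ, Cell.newOk, visit_letter _ _ _ hn hK _ _ hj, hL,
    visit_isMem _ _ _ hK _ _ hj, visit_isAcc, visit_phase L c r hn hK hL _ _ hk hj,
    Nat.mul_add_mod_self_right, Nat.mod_eq_of_lt hk]
  simp

/-- The index `ρ * K + k` with `k < K` is that of the accumulator of entry `k` in period `ρ`. -/
theorem visit_mem_step (ρ : ℕ) (X : ℤ) {k j : ℕ} (hk : k < K) (hj : j < n) :
    (visit n K L c r X (ρ * K + (k + 1)) j).mem =
      if Fin.ofNat 4 ρ = 0 then ((visit n K L c r X (ρ * K + k) j).mem.1,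
        r (2 * n * (ρ * K + k) + j) ((2 * n * K : ℕ) * X + j))
      else if Fin.ofNat 4 ρ = 3 ∧ (visit n K L c r X (ρ * K + k) j).ok then
        ((L k j).out, false)
      else (visit n K L c r X (ρ * K + k) j).mem := by
  rw [← add_assoc, visit_mem_succ _ _ _ hn, Cell.newMem, visit_letter _ _ _ hn hK _ _ hj,
    visit_isMem _ _ _ hK _ _ hj, visit_isAcc, visit_phase L c r hn hK hL _ _ hk hj,
    Nat.mul_add_mod_self_right, Nat.mod_eq_of_lt hk]
  simp

theorem visit_mem_fst_of_phase_zero (X : ℤ) {k j : ℕ} (hk : k ≤ K) (hj : j < n) :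
    (visit n K L c r X k j).mem.1 = c X j := by
  induction k with
  | zero => rw [visit_mem_zero L c r hK X hj]
  | succ k ih =>
    have h := visit_mem_step L c r hn hK hL 0 X (k := k) (by omega) hj
    simp only [zero_mul, zero_add] at h
    rw [h]
    simpa using ih (by omega)

theorem visit_mem_drawn (X : ℤ) {j : ℕ} (hj : j < n) :
    (visit n K L c r X K j).mem = drawn n K c r X j := by
  obtain ⟨k, rfl⟩ : ∃ k, K = k + 1 := ⟨K - 1, by omega⟩
  have h := visit_mem_step L c r hn hK hL 0 X (k := k) (by omega) hj
  simp only [zero_mul, zero_add] at h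
  rw [h, visit_mem_fst_of_phase_zero L c r hn hK hL X (by omega) hj]
  simp [drawn]

theorem visit_mem_of_phase_one_two (ρ : ℕ) (hρ : ρ = 1 ∨ ρ = 2) (X : ℤ) {k j : ℕ} (hk : k ≤ K)
    (hj : j < n) (h0 : (visit n K L c r X (ρ * K) j).mem = drawn n K c r X j) :
    (visit n K L c r X (ρ * K + k) j).mem = drawn n K c r X j := by
  induction k with
  | zero => exact h0
  | succ k ih =>
    rw [visit_mem_step L c r hn hK hL ρ X (by omega) hj]
    rw [if_neg (by rcases hρ with rfl | rfl <;> decide), if_neg, ih (by omega)]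
    rintro ⟨h, -⟩
    rcases hρ with rfl | rfl <;> exact absurd h (by decide)

theorem visit_mem_of_phase_one (X : ℤ) {k j : ℕ} (hk : k ≤ K) (hj : j < n) :
    (visit n K L c r X (1 * K + k) j).mem = drawn n K c r X j :=
  visit_mem_of_phase_one_two L c r hn hK hL 1 (.inl rfl) X hk hj
    (by rw [one_mul, visit_mem_drawn L c r hn hK hL X hj])

theorem visit_mem_of_phase_two (X : ℤ) {k j : ℕ} (hk : k ≤ K) (hj : j < n) :
    (visit n K L c r X (2 * K + k) j).mem = drawn n K c r X j :=
  visit_mem_of_phase_one_two L c r hn hK hL 2 (.inr rfl) X hk hj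
    (by rw [← visit_mem_of_phase_one L c r hn hK hL X le_rfl hj]; congr 2; ring)

theorem visit_ok_of_phase_zero (X : ℤ) {k j : ℕ} (hk : k < K) (hj : j ≤ n) :
    (visit n K L c r X (0 * K + k) j).ok = true := by
  induction j with
  | zero => simpa using (visit_acc_zero L c r X hk).2
  | succ j ih =>
    rw [visit_ok_step L c r hn hK hL 0 X hk hj]
    simpa using ih (by omega)

theorem visit_ok_of_phase_one (X : ℤ) {k j : ℕ} (hk : k < K) (hj : j ≤ n) :
    (visit n K L c r X (1 * K + k) j).ok = true ↔
      ∀ i < j, drawn n K c r X i = (L k i).fst := by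
  induction j with
  | zero =>
    have := visit_ok_start_succ (n := n) L c r hK 0 X k
    rw [visit_ok_of_phase_zero L c r hn hK hL _ hk le_rfl] at this
    simpa using this
  | succ j ih =>
    rw [visit_ok_step L c r hn hK hL 1 X hk hj, visit_mem_of_phase_one L c r hn hK hL X hk.le hj,
      if_pos (by decide), Bool.and_eq_true, decide_eq_true_eq, ih (by omega),
      Nat.forall_lt_succ_right]

theorem visit_ok_of_phase_two (X : ℤ) {k j : ℕ} (hk : k < K) (hj : j ≤ n) :
    (visit n K L c r X (2 * K + k) j).ok = true ↔
      (∀ i < n, drawn n K c r (X - 1) i = (L k i).fst) ∧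
        ∀ i < j, drawn n K c r X i = (L k i).snd := by
  induction j with
  | zero =>
    have := visit_ok_start_succ (n := n) L c r hK 1 X k
    rw [show (2 : ℕ) = 1 + 1 from rfl, this, visit_ok_of_phase_one L c r hn hK hL _ hk le_rfl]
    simp
  | succ j ih =>
    rw [visit_ok_step L c r hn hK hL 2 X hk hj, visit_mem_of_phase_two L c r hn hK hL X hk.le hj,
      if_neg (by decide), if_pos (by decide), Bool.and_eq_true, decide_eq_true_eq, ih (by omega),
      and_assoc, Nat.forall_lt_succ_right]

/-- When it writes, the accumulator of entry `k` is `ok` exactly if the words of the two blocks it has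
crossed before are those of the entry. -/
theorem visit_ok_of_phase_three (X : ℤ) {k j : ℕ} (hk : k < K) (hj : j < n) :
    (visit n K L c r X (3 * K + k) j).ok = true ↔
      (∀ i < n, drawn n K c r (X - 2) i = (L k i).fst) ∧
        ∀ i < n, drawn n K c r (X - 1) i = (L k i).snd := by
  induction j with
  | zero =>
    have := visit_ok_start_succ (n := n) L c r hK 2 X k
    rw [show (3 : ℕ) = 2 + 1 from rfl, this, visit_ok_of_phase_two L c r hn hK hL _ hk le_rfl,
      show X - 1 - 1 = X - 2 by ring]
  | succ j ih =>
    rw [visit_ok_step L c r hn hK hL 3 X hk (by omega)]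
    simpa [hj.ne] using ih (by omega)

theorem visit_ok_reset (X : ℤ) {k : ℕ} (hk : k < K) :
    (visit n K L c r X (4 * K + k) 0).ok = true := by
  obtain ⟨j, rfl⟩ : ∃ j, n = j + 1 := ⟨n - 1, by omega⟩
  rw [show (4 : ℕ) = 3 + 1 from rfl, visit_ok_start_succ L c r hK,
    visit_ok_step L c r hn hK hL 3 _ hk (by omega)]
  simp

/-- During phase `3`, the block is written by the accumulator of the only matching entry `k₀`. -/
theorem visit_mem_of_phase_three (X : ℤ) {k j k₀ : ℕ} (hk : k ≤ K) (hj : j < n)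
    (h₀ : ∀ k < K, ((∀ i < n, drawn n K c r (X - 2) i = (L k i).fst) ∧
        ∀ i < n, drawn n K c r (X - 1) i = (L k i).snd) ↔ k = k₀) :
    (visit n K L c r X (3 * K + k) j).mem =
      if k₀ < k then ((L k₀ j).out, false) else drawn n K c r X j := by
  induction k with
  | zero =>
    have := visit_mem_of_phase_two L c r hn hK hL X le_rfl hj
    rw [show 2 * K + K = 3 * K + 0 by ring] at this
    simpa using this
  | succ k ih =>
    have hok := (visit_ok_of_phase_three L c r hn hK hL X (k := k) (by omega) hj).trans
      (h₀ k (by omega))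
    rw [visit_mem_step L c r hn hK hL 3 X (by omega) hj, if_neg (by decide), ih (by omega)]
    rcases lt_trichotomy k k₀ with h | rfl | h
    · rw [if_neg fun h' => h.ne (hok.1 h'.2), if_neg (by omega), if_neg (by omega)]
    · rw [if_pos ⟨by decide, hok.2 rfl⟩, if_pos (by omega)]
    · rw [if_neg fun h' => h.ne' (hok.1 h'.2), if_pos h, if_pos (by omega)]

/-- After four periods the configuration codes the words found in the table, translated by two
blocks: block `X + 2` is written by an accumulator that compared the words of blocks `X` and
`X + 1`. -/
theorem sweep_encode (next : ℤ → ℕ → Bool) (entry : ℤ → ℕ) (hentry : ∀ X, entry X < K)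
    (h₀ : ∀ X, ∀ k < K, ((∀ i < n, drawn n K c r X i = (L k i).fst) ∧
        ∀ i < n, drawn n K c r (X + 1) i = (L k i).snd) ↔ k = entry X)
    (hnext : ∀ X, ∀ j < n, next X j = (L (entry X) j).out) :
    shift (2 * (2 * n * K : ℕ)) (sweep (encode n K L c) r (4 * (2 * n * K))) =
      encode n K L next := by
  funext y
  have hm : 0 < 2 * n * K := by positivity
  have hmz : (0 : ℤ) < (2 * n * K : ℕ) := by exact_mod_cast hm
  obtain ⟨X, j, hj, rfl⟩ : ∃ (X : ℤ) (j : ℕ), j < 2 * n * K ∧ y = (2 * n * K : ℕ) * X + j := by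
    refine ⟨y / (2 * n * K : ℕ), (y % (2 * n * K : ℕ)).toNat, ?_, ?_⟩
    · have := Int.emod_lt_of_pos y hmz
      have := Int.emod_nonneg y hmz.ne'
      omega
    · rw [Int.toNat_of_nonneg (Int.emod_nonneg y hmz.ne'), Int.mul_ediv_add_emod]
  rw [shift, show ((2 * n * K : ℕ) * X + j + 2 * (2 * n * K : ℕ) : ℤ) =
    (2 * n * K : ℕ) * (X + 2) + j by ring]
  set x : ℤ := (2 * n * K : ℕ) * (X + 2) + j with hx
  have hmem : (sweep (encode n K L c) r (4 * (2 * n * K)) x).mem =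
      (encode n K L next ((2 * n * K : ℕ) * X + j)).mem := by
    by_cases hjn : j < n
    -- The `j`-th memory cell is not visited between the end of the fourth period and `j` steps
    -- later, the time of its next visit.
    · have h1 := sweep_mem_of_isAcc_eq_false (encode n K L c) r (4 * (2 * n * K)) j x
        (fun i hi => encode_isAcc_eq_false L c (N := 2 * n) (i := 2 * n - (j - i) - 1) rfl
          (K * (X + 2) - 4 * K + 1) (by
            have : 2 * n - (j - i) - 1 + 1 = 2 * n - (j - i) := by omega
            rw [this, Nat.cast_sub (by omega), Nat.cast_sub (by omega), hx]
            push_cast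
            ring) (by omega))
      have h2 := visit_mem_of_phase_three L c r hn hK hL (X + 2) (k₀ := entry X) le_rfl hjn
        (fun k hk => by rw [add_sub_cancel_right, show X + 2 - 1 = X + 1 by ring]; exact h₀ X k hk)
      rw [visit, show 2 * n * (3 * K + K) + j = 4 * (2 * n * K) + j by ring, h1,
        if_pos (hentry X)] at h2
      rw [h2]
      simp only [encode, emod_block X hj, ediv_block X hj, Nat.cast_lt, hjn, if_true,
        Int.toNat_natCast, hnext X j hjn]
    · rw [sweep_mem_of_isMem_eq_false _ _ _ _
        (by rw [hx, encode_isMem_block _ _ _ hj]; simpa using hjn)]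
      simp only [encode, hx, emod_block _ hj, Nat.cast_lt, hjn, if_false]
  have hacc : (sweep (encode n K L c) r (4 * (2 * n * K)) x).phase = 0 ∧
      (sweep (encode n K L c) r (4 * (2 * n * K)) x).ok = true := by
    by_cases hdvd : ((2 * n : ℕ) : ℤ) ∣ x
    · obtain ⟨q, hq⟩ := hdvd
      -- The accumulators at time `4 * (2 * n * K)` are those about to start a new phase `0`.
      obtain ⟨Y, k, hk, rfl⟩ : ∃ (Y : ℤ) (k : ℕ), k < K ∧ q = K * Y - k := by
        have hKz : (0 : ℤ) < K := by exact_mod_cast hK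
        have h1 := Int.emod_lt_of_pos (-q) hKz
        have h2 := Int.emod_nonneg (-q) hKz.ne'
        refine ⟨-(-q / K), (-q % K).toNat, by omega, ?_⟩
        rw [Int.toNat_of_nonneg h2]
        linarith [Int.mul_ediv_add_emod (-q) K]
      have h := sweep_acc_before_block (n := n) L c r (4 * (2 * n * K)) Y hk
      have h1 := visit_phase_start L c r hn hK hL 4 Y hk
      have h2 := visit_ok_reset L c r hn hK hL Y hk
      rw [visit, show 2 * n * (4 * K + k) + 0 = 4 * (2 * n * K) + 2 * n * k by ring,
        Nat.cast_zero, add_zero] at h1 h2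
      rw [h1, h2, show ((2 * n * K : ℕ) * Y - (2 * n * k : ℕ) : ℤ) = x by
        rw [hq]; push_cast; ring] at h
      exact ⟨h.1.symm, h.2.symm⟩
    · have h := sweep_acc_of_isAcc_eq_false (encode n K L c) r (4 * (2 * n * K))
        (x - (4 * (2 * n * K) : ℕ)) (by
          simp only [encode, decide_eq_false_iff_not]
          intro h
          refine hdvd ((Int.dvd_iff_dvd_of_dvd_sub ?_).1 h)
          refine ⟨-(4 * K), ?_⟩
          push_cast
          ring)
      rw [sub_add_cancel] at h
      exact h
  have hper : ∀ d : ℤ, (x + (2 * n * K : ℕ) * d) % (2 * n * K : ℕ) = j := fun d => by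
    rw [Int.add_mul_emod_self_left, hx, emod_block _ hj]
  have hletter : (sweep (encode n K L c) r (4 * (2 * n * K)) x).letter =
      (encode n K L next ((2 * n * K : ℕ) * X + j)).letter := by
    rw [sweep_letter]
    have := hper 4
    rw [show (x + (2 * n * K : ℕ) * 4) = x + (4 * (2 * n * K) : ℕ) by push_cast; ring] at this
    simp only [encode, this, emod_block X hj]
  have hisMem : (sweep (encode n K L c) r (4 * (2 * n * K)) x).isMem =
      (encode n K L next ((2 * n * K : ℕ) * X + j)).isMem := by
    rw [sweep_isMem, hx, encode_isMem_block _ _ _ hj, encode_isMem_block _ _ _ hj]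
  have hisAcc : (sweep (encode n K L c) r (4 * (2 * n * K)) x).isAcc =
      (encode n K L next ((2 * n * K : ℕ) * X + j)).isAcc := by
    rw [sweep_isAcc]
    simp only [encode]
    congr 1
    refine propext (Int.dvd_iff_dvd_of_dvd_sub ⟨-2 * K, ?_⟩)
    rw [hx]
    push_cast
    ring
  generalize hA : sweep (encode n K L c) r (4 * (2 * n * K)) x = a at *
  generalize hB : encode n K L next ((2 * n * K : ℕ) * X + j) = b at *
  have hb1 : b.phase = 0 := by rw [← hB]; rfl
  have hb2 : b.ok = true := by rw [← hB]; rfl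
  cases a; cases b
  simp_all

end Phases
/-! ### Simulation of two-cell rules on words -/
theorem encode_block {n K : ℕ} (L : ℕ → ℕ → Letter) (c : ℤ → ℕ → Bool) (X : ℤ) {j : ℕ}
    (hj : j < 2 * n * K) :
    encode n K L c ((2 * n * K : ℕ) * X + j) = encode n K L (fun _ => c X) j := by
  have h : (j : ℤ) % (2 * n * K : ℕ) = j := by simpa using emod_block 0 hj
  have hdvd : ((2 * n : ℕ) : ℤ) ∣ (2 * n * K : ℕ) * X + j ↔ ((2 * n : ℕ) : ℤ) ∣ j :=
    Int.dvd_iff_dvd_of_dvd_sub ⟨K * X, by push_cast; ring⟩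
  simp only [encode, emod_block X hj, ediv_block X hj, h, hdvd]

/-- A word of length `n` as a function on `ℕ`. -/
def padWord {n : ℕ} (q : Fin n → Bool) (j : ℕ) : Bool := if h : j < n then q ⟨j, h⟩ else false

/-- The block of cells that codes the word `q`. -/
def encodeBlock (n K : ℕ) (L : ℕ → ℕ → Letter) (q : Fin n → Bool) (i : Fin (2 * n * K)) : Cell :=
  encode n K L (fun _ => padWord q) i

theorem encodeBlock_injective {n K : ℕ} (hK : 0 < K) (L : ℕ → ℕ → Letter) :
    Function.Injective (encodeBlock n K L) := by
  intro q q' h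
  funext j
  have hj : (j : ℕ) < 2 * n * K := lt_block hK (by omega)
  have h' := congrArg Cell.mem (congrFun h ⟨j, hj⟩)
  have e : ((j : ℕ) : ℤ) % (2 * n * K : ℕ) = (j : ℕ) := by simpa using emod_block 0 hj
  simpa only [encodeBlock, encode, e, Nat.cast_lt, j.2, if_true, Int.toNat_natCast, padWord,
    dif_pos, Prod.mk.injEq, and_true] using h'

theorem pack_encode {n K : ℕ} {m : ℕ+} (hm : (m : ℕ) = 2 * n * K) (L : ℕ → ℕ → Letter)
    (c : ℤ → Fin n → Bool) :
    pack m (encode n K L fun X => padWord (c X)) =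
      (fun q => encodeBlock n K L q ∘ Fin.cast hm) ∘ c := by
  funext X j
  simp only [pack, hm, Function.comp_apply, encodeBlock]
  exact encode_block L _ X (hm ▸ j.2)

/-- The program whose table is the graph of `G`, enumerated by `T`. -/
noncomputable def lookup {n K : ℕ} (T : Fin K ≃ (Fin n → Bool × Bool) × (Fin n → Bool × Bool))
    (G : (Fin n → Bool × Bool) → (Fin n → Bool × Bool) → Fin n → Bool) (k j : ℕ) : Letter :=
  if h : k < K ∧ j < n then
    { fst := (T ⟨k, h.1⟩).1 ⟨j, h.2⟩
      snd := (T ⟨k, h.1⟩).2 ⟨j, h.2⟩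
      out := G (T ⟨k, h.1⟩).1 (T ⟨k, h.1⟩).2 ⟨j, h.2⟩
      last := decide (j + 1 = n) }
  else ⟨(false, false), (false, false), false, decide (j + 1 = n)⟩

theorem sweep_lookup {n K : ℕ} (hn : 0 < n)
    (T : Fin K ≃ (Fin n → Bool × Bool) × (Fin n → Bool × Bool))
    (G : (Fin n → Bool × Bool) → (Fin n → Bool × Bool) → Fin n → Bool)
    (c : ℤ → Fin n → Bool) (r : ℕ → ℤ → Bool) :
    shift (2 * (2 * n * K : ℕ)) (sweep (encode n K (lookup T G) fun X => padWord (c X)) r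
        (4 * (2 * n * K))) =
      encode n K (lookup T G) fun X => padWord
        (G (fun j => (c X j, r (2 * n * (K - 1) + j) ((2 * n * K : ℕ) * X + (j : ℕ))))
          (fun j => (c (X + 1) j,
            r (2 * n * (K - 1) + j) ((2 * n * K : ℕ) * (X + 1) + (j : ℕ))))) := by
  have hK : 0 < K := (T.symm (fun _ => (false, false), fun _ => (false, false))).pos
  set p : ℤ → Fin n → Bool × Bool := fun X j =>
    (c X j, r (2 * n * (K - 1) + j) ((2 * n * K : ℕ) * X + (j : ℕ))) with hp
  have hdrawn (X : ℤ) (j : Fin n) : drawn n K (fun X => padWord (c X)) r X j = p X j := by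
    simp [drawn, padWord, hp]
  refine sweep_encode (lookup T G) _ r hn hK ?_ (fun X => padWord (G (p X) (p (X + 1))))
    (fun X => T.symm (p X, p (X + 1))) (fun X => Fin.is_lt _) (fun X k hk => ?_) fun X j hj => ?_
  · intro k j
    unfold lookup
    split <;> rfl
  · have h1 : (∀ i < n, drawn n K (fun X => padWord (c X)) r X i = (lookup T G k i).fst) ↔
        p X = (T ⟨k, hk⟩).1 := by
      rw [funext_iff, Fin.forall_iff]
      refine forall₂_congr fun i hi => ?_
      rw [← hdrawn X ⟨i, hi⟩, lookup, dif_pos ⟨hk, hi⟩]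
    have h2 : (∀ i < n, drawn n K (fun X => padWord (c X)) r (X + 1) i = (lookup T G k i).snd) ↔
        p (X + 1) = (T ⟨k, hk⟩).2 := by
      rw [funext_iff, Fin.forall_iff]
      refine forall₂_congr fun i hi => ?_
      rw [← hdrawn (X + 1) ⟨i, hi⟩, lookup, dif_pos ⟨hk, hi⟩]
    rw [h1, h2, ← Prod.ext_iff (x := (p X, p (X + 1))), ← Equiv.symm_apply_eq, eq_comm,
      Fin.ext_iff]
  · simp [padWord, lookup, hj]

/-- A rescaling of `sweepCA` realizes, on coded words, the map that completes each word by random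
bits and then applies `G` to each pair of consecutive words; each choice of the random bits is
possible, and nothing else is. -/
theorem exists_sweepCA_simulation {n : ℕ} (hn : 0 < n)
    (G : (Fin n → Bool × Bool) → (Fin n → Bool × Bool) → Fin n → Bool) :
    ∃ (m t : ℕ+) (z : ℤ) (E : (Fin n → Bool) → (Fin m → Cell)), Function.Injective E ∧
      ∀ c : ℤ → Fin n → Bool,
        (∀ s, ∃ ω : ℤ → Fin n → Bool, sweepCA.rescaleFun m t z (E ∘ c) s = E ∘ fun X =>
          G (fun j => (c X j, ω X j)) (fun j => (c (X + 1) j, ω (X + 1) j))) ∧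
        ∀ ω : ℤ → Fin n → Bool, ∃ s, sweepCA.rescaleFun m t z (E ∘ c) s = E ∘ fun X =>
          G (fun j => (c X j, ω X j)) (fun j => (c (X + 1) j, ω (X + 1) j)) := by
  obtain ⟨K, ⟨T⟩⟩ := Finite.exists_equiv_fin ((Fin n → Bool × Bool) × (Fin n → Bool × Bool))
  replace T := T.symm
  have hK : 0 < K := (T.symm (fun _ => (false, false), fun _ => (false, false))).pos
  have hpos : 0 < 2 * n * K := by positivity
  obtain ⟨m, hm⟩ : ∃ m : ℕ+, (m : ℕ) = 2 * n * K := ⟨⟨_, hpos⟩, rfl⟩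
  obtain ⟨t, ht⟩ : ∃ t : ℕ+, (t : ℕ) = 4 * (2 * n * K) := ⟨⟨_, by omega⟩, rfl⟩
  have key (c : ℤ → Fin n → Bool) (r : ℕ → ℤ → Bool) :
      pack m (shift (2 * (2 * n * K : ℕ)) (sweepCA.iterFun t
        (unpack m ((fun q => encodeBlock n K (lookup T G) q ∘ Fin.cast hm) ∘ c)) fun k => r k)) =
      (fun q => encodeBlock n K (lookup T G) q ∘ Fin.cast hm) ∘ fun X =>
        G (fun j => (c X j, r (2 * n * (K - 1) + j) ((2 * n * K : ℕ) * X + (j : ℕ))))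
          (fun j => (c (X + 1) j,
            r (2 * n * (K - 1) + j) ((2 * n * K : ℕ) * (X + 1) + (j : ℕ)))) := by
    have h := sweep_lookup hn T G c r
    rw [← ht, sweep, ← unpack_pack m (encode n K (lookup T G) fun X => padWord (c X)),
      pack_encode hm] at h
    exact (congrArg (pack m) h).trans (pack_encode hm _ _)
  refine ⟨m, t, 2 * (2 * n * K : ℕ), fun q => encodeBlock n K (lookup T G) q ∘ Fin.cast hm,
    fun q q' h => encodeBlock_injective hK (lookup T G) ?_, fun c => ⟨fun s => ?_, fun ω => ?_⟩⟩
  · funext i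
    simpa using congrFun h (Fin.cast hm.symm i)
  · refine ⟨_, Eq.trans ?_ (key c fun k =>
      if h : k < t then unpack m fun j => s j ⟨k, h⟩ else fun _ => false)⟩
    simp only [Fin.is_lt, dif_pos]
    rfl
  -- The bit `ω X j` is fed to the `j`-th memory cell of block `X` at time `2 * n * (K - 1) + j`, the
  -- time of its last draw.
  · have hω (X : ℤ) (j : Fin n) :
        ω (((2 * n * K : ℕ) * X + (j : ℕ)) / (2 * n * K : ℕ)) j = ω X j := by
      rw [ediv_block X (lt_block hK (by omega))]
    have h := key c fun k y => padWord (ω (y / (2 * n * K : ℕ))) (k - 2 * n * (K - 1))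
    simp only [Nat.add_sub_cancel_left, padWord, Fin.is_lt, dif_pos, Fin.eta, hω] at h
    refine ⟨fun X k => pack m (fun y => padWord (ω (y / (2 * n * K : ℕ)))
      (k - 2 * n * (K - 1))) X, Eq.trans ?_ h⟩
    simp only [rescaleFun]
    congr 3
    funext k
    exact unpack_pack m _

/-! ### Universality -/

/-- After packing, every stochastic CA has its neighborhoods inside `{0, 1}`. -/
theorem exists_rescale_two_cells (B : StochasticCA.{u, v}) :
    ∃ (m : ℕ+) (z : ℤ) (g : (B.rescale m 1 z).Q → (B.rescale m 1 z).R → (B.rescale m 1 z).Q →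
        (B.rescale m 1 z).R → (B.rescale m 1 z).Q), ∀ c s x,
      (B.rescale m 1 z).globalFun c s x = g (c x) (s x) (c (x + 1)) (s (x + 1)) := by
  obtain ⟨b, hb⟩ : ∃ b : ℕ, ∀ a ∈ B.V ∪ B.V', |a| ≤ b := by
    refine ⟨(B.V ∪ B.V').sup Int.natAbs, fun a ha => ?_⟩
    rw [Int.abs_eq_natAbs]
    exact_mod_cast Finset.le_sup (f := Int.natAbs) ha
  have hnbhd (N : Finset ℤ) (hN : N ⊆ B.V ∪ B.V') :
      ∀ a ∈ blockNbhd ⟨2 * b + 1, by omega⟩ b N, a = 0 ∨ a = 1 := by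
    intro a ha
    simp only [blockNbhd, Finset.mem_biUnion, Finset.mem_univ, true_and, Finset.mem_image] at ha
    obtain ⟨j, y, hy, rfl⟩ := ha
    have h1 := abs_le.1 (hb y (hN hy))
    have h2 : ((j : ℕ) : ℤ) < 2 * b + 1 := by exact_mod_cast j.2
    have h3 : (0 : ℤ) ≤ (((j : ℕ) : ℤ) + b + y) / (2 * b + 1) :=
      Int.ediv_nonneg (by omega) (by omega)
    have h4 : (((j : ℕ) : ℤ) + b + y) / (2 * b + 1) < 2 :=
      Int.ediv_lt_of_lt_mul (by omega) (by omega)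
    simp only [PNat.mk_coe, Nat.cast_add, Nat.cast_mul, Nat.cast_ofNat, Nat.cast_one]
    omega
  -- If `b` bounds the neighborhoods, a block of `2 * b + 1` cells translated by `b` depends on the
  -- `4 * b + 1` cells from its first one on, hence on two blocks.
  refine ⟨⟨2 * b + 1, by omega⟩, b, fun q e q' e' => (B.rescale ⟨2 * b + 1, by omega⟩ 1 b).f
    (fun a => if (a : ℤ) = 0 then q else q') (fun a => if (a : ℤ) = 0 then e else e'),
    fun c s x => ?_⟩
  simp only [globalFun]
  congr 1
  · funext a
    rcases hnbhd _ (by simp [reach]) a a.2 with h | h <;> simp [h]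
  · funext a
    rcases hnbhd _ (fun y hy => by simp_all [randReach]) a a.2 with h | h <;> simp [h]

/-- The intermediate state set is the range of the injection, so that it lives in the universe of the
states of `A₂`; the projection is then the inverse bijection. -/
theorem NSub.nMix {A₁ : StochasticCA.{u, v}} {A₂ : StochasticCA.{w, x}} (h : NSub A₁ A₂) :
    NMix A₁ A₂ := by
  obtain ⟨i, hi, hs, h⟩ := h
  let π : Set.range i ≃ A₁.Q := (Equiv.ofInjective i hi).symm
  have hval (q : Set.range i) : i (π q) = q :=
    congrArg Subtype.val ((Equiv.ofInjective i hi).apply_symm_apply q)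
  have hs' : A₂.IsStable (Subtype.val : Set.range i → A₂.Q) := by
    intro c s hc z
    rw [Subtype.range_coe] at hc ⊢
    exact hs c s hc z
  have hne : Nonempty (Set.range i) := A₁.nonempty_Q.map π.symm
  have hc : (A₂.restrict Subtype.val Subtype.val_injective hs').IsCompatible π := by
    intro s c c' hcc
    rw [π.injective.comp_left hcc]
  refine ⟨Set.range i, hne, Subtype.val, Subtype.val_injective, hs', π, π.surjective, hc, ?_⟩
  have hfun (c : ℤ → A₁.Q) (s : ℤ → A₂.R) : (A₂.restrict i hi hs).globalFun c s =
      ((A₂.restrict Subtype.val Subtype.val_injective hs').project π π.surjective hc).globalFun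
        c s := by
    obtain ⟨c', rfl⟩ : ∃ c' : ℤ → Set.range i, π ∘ c' = c :=
      ⟨π.symm ∘ c, funext fun z => π.apply_symm_apply (c z)⟩
    have hic : i ∘ π ∘ c' = Subtype.val ∘ c' := funext fun z => hval (c' z)
    refine hi.comp_left ((restrict_globalFun A₂ i hi hs (π ∘ c') s).trans ?_)
    refine Eq.trans ?_ (congrArg (i ∘ ·) (project_globalFun
      (A₂.restrict Subtype.val Subtype.val_injective hs') π π.surjective hc c' s).symm)
    rw [hic]
    refine (restrict_globalFun A₂ _ Subtype.val_injective hs' c' s).symm.trans ?_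
    exact funext fun z => (hval _).symm
  refine h.trans (funext fun c => Set.ext fun d => ?_)
  exact ⟨fun ⟨s, hs⟩ => ⟨s, (hfun c s).symm.trans hs⟩, fun ⟨s, hs⟩ => ⟨s, (hfun c s).trans hs⟩⟩

/-- States are coded by words through an injection `eQ`; random symbols are obtained from words
through the surjection inverse to an injection `eR`. -/
theorem exists_nSub_sweepCA (A : StochasticCA.{u, v}) (g : A.Q → A.R → A.Q → A.R → A.Q)
    (hg : ∀ c s x, A.globalFun c s x = g (c x) (s x) (c (x + 1)) (s (x + 1))) :
    ∃ (m t : ℕ+) (z : ℤ), NSub A (sweepCA.rescale m t z) := by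
  obtain ⟨n, hn, ⟨eQ⟩, ⟨eR⟩⟩ : ∃ n : ℕ, 0 < n ∧ Nonempty (A.Q ↪ (Fin n → Bool)) ∧
      Nonempty (A.R ↪ (Fin n → Bool)) := by
    have := Fintype.ofFinite A.Q
    have := Fintype.ofFinite A.R
    refine ⟨Fintype.card A.Q + Fintype.card A.R, Nat.add_pos_left Fintype.card_pos _,
      Function.Embedding.nonempty_of_card_le ?_, Function.Embedding.nonempty_of_card_le ?_⟩ <;>
    · rw [Fintype.card_fun, Fintype.card_bool, Fintype.card_fin]
      exact le_trans (by omega) Nat.lt_two_pow_self.le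
  have hdQ := Function.leftInverse_invFun eQ.injective
  have hdR := Function.invFun_surjective eR.injective
  obtain ⟨m, t, z, E, hE, hsim⟩ := exists_sweepCA_simulation hn fun p p' =>
    eQ (g (Function.invFun eQ fun j => (p j).1) (Function.invFun eR fun j => (p j).2)
      (Function.invFun eQ fun j => (p' j).1) (Function.invFun eR fun j => (p' j).2))
  have hstep (c : ℤ → A.Q) (ω : ℤ → Fin n → Bool) :
      (E ∘ fun X => eQ (g (Function.invFun eQ fun j => eQ (c X) j) (Function.invFun eR (ω X))
        (Function.invFun eQ fun j => eQ (c (X + 1)) j) (Function.invFun eR (ω (X + 1))))) =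
      (E ∘ eQ) ∘ A.globalFun c fun X => Function.invFun eR (ω X) := by
    funext X
    simp only [Function.comp_apply, hg]
    rw [hdQ (c X), hdQ (c (X + 1))]
  have hdown (c : ℤ → A.Q) (s : ℤ → (sweepCA.rescale m t z).R) : ∃ s' : ℤ → A.R,
      (sweepCA.rescale m t z).globalFun ((E ∘ eQ) ∘ c) s = (E ∘ eQ) ∘ A.globalFun c s' := by
    obtain ⟨ω, hω⟩ := (hsim (eQ ∘ c)).1 s
    exact ⟨_, (rescale_globalFun ..).trans (hω.trans (hstep c ω))⟩
  have hup (c : ℤ → A.Q) (s' : ℤ → A.R) : ∃ s : ℤ → (sweepCA.rescale m t z).R,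
      (sweepCA.rescale m t z).globalFun ((E ∘ eQ) ∘ c) s = (E ∘ eQ) ∘ A.globalFun c s' := by
    choose ω hω using fun X => hdR (s' X)
    obtain ⟨s, hs⟩ := (hsim (eQ ∘ c)).2 ω
    refine ⟨s, (rescale_globalFun ..).trans (hs.trans ((hstep c ω).trans ?_))⟩
    simp only [hω]
  have hi : Function.Injective (E ∘ eQ) := hE.comp eQ.injective
  have hstable : (sweepCA.rescale m t z).IsStable (E ∘ eQ) := by
    intro c s hc x
    choose c' hc' using hc
    obtain ⟨s', hs'⟩ := hdown c' s
    obtain rfl : (E ∘ eQ) ∘ c' = c := funext hc'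
    exact ⟨_, (congrFun hs' x).symm⟩
  refine ⟨m, t, z, E ∘ eQ, hi, hstable, ?_⟩
  funext c
  ext d
  constructor
  · rintro ⟨s', rfl⟩
    obtain ⟨s, hs⟩ := hup c s'
    exact ⟨s, hi.comp_left ((restrict_globalFun _ _ hi hstable c s).trans hs)⟩
  · rintro ⟨s, rfl⟩
    obtain ⟨s', hs'⟩ := hdown c s
    exact ⟨s', hi.comp_left (hs'.symm.trans (restrict_globalFun _ _ hi hstable c s).symm)⟩

end StochasticCA

theorem mainTheorem10 :
    ∃ U : StochasticCA.{0, 0}, U.IsCorrelationFree ∧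
      StochasticCA.IsUniversal (StochasticCA.NSimInj.{u, v, 0, 0}) U ∧
      StochasticCA.IsUniversal (StochasticCA.NSimMix.{u, v, 0, 0}) U := by
  have h (B : StochasticCA.{u, v}) : ∃ (m₁ m₂ t₁ t₂ : ℕ+) (z₁ z₂ : ℤ),
      StochasticCA.NSub (B.rescale m₁ t₁ z₁) (StochasticCA.sweepCA.rescale m₂ t₂ z₂) := by
    obtain ⟨m₁, z₁, g, hg⟩ := B.exists_rescale_two_cells
    obtain ⟨m₂, t₂, z₂, hsub⟩ := StochasticCA.exists_nSub_sweepCA _ g hg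
    exact ⟨m₁, m₂, 1, t₂, z₁, z₂, hsub⟩
  refine ⟨StochasticCA.sweepCA, rfl, h, fun B => ?_⟩
  obtain ⟨m₁, m₂, t₁, t₂, z₁, z₂, hsub⟩ := h B
  exact ⟨m₁, m₂, t₁, t₂, z₁, z₂, hsub.nMix⟩
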